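/- Let $p$ be an odd prime, let $m>1$ and $k\ge 1$ be integers, and put $e=2m$, $q=p^e$, $d=\gcd(k,e)$. Assume that $e/d$ is even and put $s=m/d$. Let $\mathrm{Tr}$ be the trace from $\mathbb{F}_q$ to $\mathbb{F}_p$, let $a\in\mathbb{F}_q^*$, let $$D_0=\{x\in\mathbb{F}_q^* : \mathrm{Tr}(a x^{p^k+1})=0\},$$ and let $C_{D_0}=\{(\mathrm{Tr}(bx))_{x\in D_0} : b\in\mathbb{F}_q\}$. Suppose that $a^{(q-1)/(p^d+1)}\neq(-1)^s$. Then $C_{D_0}$ is a two-weight linear code over $\mathbb{F}_p$ of length $$n=p^{e-1}+(-1)^s(p-1)p^{m-1}-1$$ and dimension $e$. If $A_i$ denotes the number of codewords of Hamming weight $i$, its weight enumerator $1+A_1z+\cdots+A_nz^n$ equals $$1+\bigl(p^{e-1}+(-1)^s(p-1)p^{m-1}-1\bigr)z^{(p-1)p^{e-2}}+(p-1)\bigl(p^{e-1}-(-1)^sp^{m-1}\bigr)z^{(p-1)(p^{e-2}+(-1)^sp^{m-1})}.$$ Its complete weight enumerator, that is, the sum over all codewords $\mathsf{c}$ of the monomials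 $\prod_{\rho\in\mathbb{F}_p}w_\rho^{N_\rho(\mathsf{c})}$, where $N_\rho(\mathsf{c})$ is the number of components of $\mathsf{c}$ equal to $\rho$, equals $$\begin{aligned}&w_0^{\,p^{e-1}+(-1)^s(p-1)p^{m-1}-1}+\bigl(p^{e-1}+(-1)^s(p-1)p^{m-1}-1\bigr)\,w_0^{\,p^{e-2}+(-1)^s(p-1)p^{m-1}-1}\prod_{\rho\in\mathbb{F}_p^*}w_\rho^{\,p^{e-2}}\\&+(p-1)\bigl(p^{e-1}-(-1)^sp^{m-1}\bigr)\,w_0^{\,p^{e-2}-1}\prod_{\rho\in\mathbb{F}_p^*}w_\rho^{\,p^{e-2}+(-1)^sp^{m-1}}.\end{aligned}$$ -/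

import Mathlib

open scoped Polynomial

noncomputable section

namespace LinCode

section General

variable {K ι : Type*} [Field K] [Fintype K] [Fintype ι]

open Classical in
/-- `A_i`: the number of codewords of Hamming weight `i` in a linear code `C`, a subspace of
the space of words with letters in `K` and positions in `ι`. -/
def weightCount (C : Submodule K (ι → K)) (i : ℕ) : ℕ :=
  Set.ncard {c : ι → K | c ∈ C ∧ hammingNorm c = i}

/-- The weight enumerator `1 + A_1 z + ... + A_n z^n`, where `n` is the length of the code. -/
def weightEnumerator (C : Submodule K (ι → K)) : ℤ[X] :=
  1 + ∑ i ∈ Finset.Icc 1 (Fintype.card ι), Polynomial.C (weightCount C i : ℤ) * Polynomial.X ^ i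

/-- A `t`-weight code: exactly `t` of the numbers `A_1, ..., A_n` are nonzero. -/
def IsTWeight (t : ℕ) (C : Submodule K (ι → K)) : Prop :=
  ((Finset.Icc 1 (Fintype.card ι)).filter (fun i => weightCount C i ≠ 0)).card = t

open Classical in
/-- The number of components of the word `c` that are equal to `ρ`. -/
def symbolCount (c : ι → K) (ρ : K) : ℕ :=
  (Finset.univ.filter (fun i => c i = ρ)).card

/-- The complete weight enumerator of a word: the product of `w_ρ ^ (symbolCount c ρ)` over all
letters `ρ`, a monomial in variables `w_ρ` indexed by the elements of `K`. -/
def wordCWE (c : ι → K) : MvPolynomial K ℤ :=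
  ∏ ρ : K, MvPolynomial.X ρ ^ symbolCount c ρ

open Classical in
/-- The complete weight enumerator of a code: the sum over its codewords. -/
def completeWeightEnumerator (C : Submodule K (ι → K)) : MvPolynomial K ℤ :=
  ∑ c ∈ Finset.univ.filter (fun c : ι → K => c ∈ C), wordCWE c

end General

section TraceCode

variable (p : ℕ) [Fact p.Prime] {F : Type*} [Field F] [Algebra (ZMod p) F]

/-- The encoding map `b ↦ (Tr (b x))_{x ∈ D}`, with `Tr` the absolute trace. -/
def traceEncode (D : Finset F) : F →ₗ[ZMod p] (D → ZMod p) where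
  toFun b := fun x => Algebra.trace (ZMod p) F (b * (x : F))
  map_add' b b' := by
    funext x
    simp [add_mul]
  map_smul' r b := by
    funext x
    simp

/-- The code `C_D = {(Tr (b x))_{x ∈ D} : b ∈ F}` with defining set `D`. -/
def traceCode (D : Finset F) : Submodule (ZMod p) (D → ZMod p) :=
  LinearMap.range (traceEncode p D)

open Classical in
/-- The defining set `D_c = {x ≠ 0 : Tr (a x^(p^k+1)) = c}`. -/
def definingSet [Fintype F] (k : ℕ) (a : F) (c : ZMod p) : Finset F :=
  Finset.univ.filter
    (fun x : F => x ≠ 0 ∧ Algebra.trace (ZMod p) F (a * x ^ (p ^ k + 1)) = c)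

end TraceCode

end LinCode

end

/-!
Put `q = p ^ e` and `Q x = Tr (a x ^ (p ^ k + 1))`, a quadratic form on `F` over the prime field.
The code is governed by the exponential sum `G = ∑ ψ (Q x)`, and neither a diagonalisation of `Q` nor a
quadratic Gauss sum is needed to find it.

* `Q` is nondegenerate (`frobeniusForm_nondegenerate`). If `x ≠ 0` lies in the radical, then
  `y = a x ^ (p ^ k + 1)` satisfies `y ^ (p ^ k) = -y`; as `k / d` is odd, this gives
  `y ^ (p ^ d) = -y`, and then `a ^ ((q - 1) / (p ^ d + 1)) = (-1) ^ s`, which is excluded.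
* Every nonzero element `t` of the prime field is of the form `μ ^ (p ^ k + 1)` with `μ` in `F`, so
  `Q` is equivalent to `t Q` (`frobeniusForm_similitude`). Hence `∑ ψ (t Q x) = G` for all `t ≠ 0`,
  and `G = q - p N` is a rational integer, where `N` is the number of solutions of `Q x = 1`. Since
  `Q` is nondegenerate, `G ^ 2 = q`, that is, `G = ± p ^ m`.
* The `(p ^ d + 1)`-th roots of unity act freely on the solutions of `Q x = 1`, so `p ^ d + 1`
  divides `N` and `G ≡ q ≡ 1` modulo `p ^ d + 1`. As `p ^ m ≡ (-1) ^ s`, the sign is determined: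
  `G = (-1) ^ s p ^ m` (`sum_addChar_frobeniusForm`).

By nondegeneracy the functionals `x ↦ Tr (b x)` are the functionals `x ↦ polar Q y x`
(`traceCode_eq_range_polarEncode`). Completing the square in `t Q x + r polar Q y x` expresses the
number of `x` with `Q x = 0` and `polar Q y x = ρ` by `G` (`card_quadratic_eq_zero_polar_eq`); for
`y ≠ 0` it depends only on whether `Q y = 0` and whether `ρ = 0`. So there are three kinds of
codewords, those of `y = 0`, of the other zeros `y` of `Q`, and of the `y` with `Q y ≠ 0`; their
letter counts give both enumerators (`polarCode_enumerators`).
-/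

noncomputable section

namespace LinCode

/-! ### Exponential sums of quadratic forms that are similar to all their multiples -/

section GaussSum

variable {K V : Type*} [Field K] [AddCommGroup V] [Module K V] [Fintype V]
  {ψ : AddChar K ℂ} {Q : QuadraticForm K V}

open Classical in
lemma sum_addChar_linear (hψ : ψ ≠ 1) (L : V →ₗ[K] K) :
    ∑ x, ψ (L x) = if L = 0 then (Fintype.card V : ℂ) else 0 := by
  split_ifs with h
  · simp [h]
  · have h1 : ψ.compAddMonoidHom L.toAddMonoidHom ≠ 0 := by
      obtain ⟨c, hc⟩ := AddChar.ne_one_iff.1 hψ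
      obtain ⟨x, hx⟩ := LinearMap.surjective h c
      intro h0
      apply hc
      have := DFunLike.congr_fun h0 x
      simpa [hx] using this
    simpa using (AddChar.sum_eq_zero_iff_ne_zero).2 h1

/-- The exponential sum of a nondegenerate quadratic form has squared modulus `|V|`. -/
lemma sum_addChar_quadratic_mul_neg (hψ : ψ ≠ 1)
    (hQ : ∀ x, (∀ y, QuadraticMap.polar Q x y = 0) → x = 0) :
    (∑ x, ψ (Q x)) * ∑ x, ψ (-Q x) = Fintype.card V := by
  classical
  have h1 : ∀ z, ∑ y, ψ (QuadraticMap.polar Q z y) =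
      if z = 0 then (Fintype.card V : ℂ) else 0 := by
    intro z
    have := sum_addChar_linear hψ (QuadraticMap.polarBilin Q z)
    simp only [QuadraticMap.polarBilin_apply_apply] at this
    rw [this]
    congr 1
    refine propext ⟨fun h => hQ z fun y => ?_, fun h => by simp [h]⟩
    simpa using DFunLike.congr_fun h y
  calc _ = ∑ y, ∑ x, ψ (Q x) * ψ (-Q y) := by
        rw [Finset.sum_mul_sum, Finset.sum_comm]
    _ = ∑ y, ∑ z, ψ (Q z) * ψ (QuadraticMap.polar Q z y) := by
        refine Finset.sum_congr rfl fun y _ => ?_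
        rw [← Equiv.sum_comp (Equiv.addRight y)]
        refine Finset.sum_congr rfl fun z _ => ?_
        rw [← AddChar.map_add_eq_mul, ← AddChar.map_add_eq_mul]
        congr 1
        simp [QuadraticMap.polar]
        ring
    _ = ∑ z, ψ (Q z) * ∑ y, ψ (QuadraticMap.polar Q z y) := by
        rw [Finset.sum_comm]
        simp [Finset.mul_sum]
    _ = _ := by simp [h1]

/-- If for each `t ≠ 0` a permutation of `V` carries `Q` to `t Q`, these multiples all
have the same exponential sum. -/
lemma sum_addChar_smul_quadratic (hsim : ∀ t : K, t ≠ 0 → ∃ g : V ≃ V, ∀ x, Q (g x) = t * Q x)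
    {t : K} (ht : t ≠ 0) : ∑ x, ψ (t * Q x) = ∑ x, ψ (Q x) := by
  obtain ⟨g, hg⟩ := hsim t ht
  rw [← Equiv.sum_comp g fun x => ψ (Q x)]
  simp [hg]

/-- Completing the square: `t Q x + s polar Q y x = t Q (x + (s / t) y) - (s ^ 2 / t) Q y`. The
translation does not change the sum over `x`, and `t Q` has the same sum as `Q`. -/
lemma sum_addChar_smul_quadratic_add_polar
    (hsim : ∀ t : K, t ≠ 0 → ∃ g : V ≃ V, ∀ x, Q (g x) = t * Q x)
    {t : K} (ht : t ≠ 0) (s : K) (y : V) :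
    ∑ x, ψ (t * Q x + s * QuadraticMap.polar Q y x) =
      (∑ x, ψ (Q x)) * ψ (t⁻¹ * (-s ^ 2 * Q y)) := by
  rw [← sum_addChar_smul_quadratic hsim ht, Finset.sum_mul,
    ← Equiv.sum_comp (Equiv.addRight ((s / t) • y)) fun x => ψ (t * Q x) * _]
  refine Finset.sum_congr rfl fun x _ => ?_
  rw [← AddChar.map_add_eq_mul]
  congr 1
  have h1 : Q (x + (s / t) • y) = Q x + (s / t) * (s / t) * Q y
      + (s / t) * QuadraticMap.polar Q y x := by
    rw [QuadraticMap.map_add (⇑Q), QuadraticMap.map_smul, QuadraticMap.polar_smul_right,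
      QuadraticMap.polar_comm]
    simp
  simp only [Equiv.coe_addRight, h1]
  field_simp
  ring

variable [Fintype K]

lemma sum_addChar_mul [DecidableEq K] (hψ : ψ ≠ 1) (c : K) :
    ∑ t, ψ (t * c) = if c = 0 then (Fintype.card K : ℂ) else 0 := by
  have h := sum_addChar_linear hψ (LinearMap.mulRight K c)
  simp only [LinearMap.mulRight_apply] at h
  rw [h]
  congr 1
  simp

lemma sum_ne_zero_addChar_mul [DecidableEq K] (hψ : ψ ≠ 1) (c : K) :
    ∑ t ∈ Finset.univ.erase 0, ψ (t * c) = (if c = 0 then (Fintype.card K : ℂ) else 0) - 1 := by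
  rw [← sum_addChar_mul hψ c, ← Finset.add_sum_erase _ _ (Finset.mem_univ (0 : K))]
  simp

lemma card_quadratic_eq [DecidableEq K] (hψ : ψ ≠ 1)
    (hsim : ∀ t : K, t ≠ 0 → ∃ g : V ≃ V, ∀ x, Q (g x) = t * Q x) (c : K) :
    (Fintype.card K : ℂ) * (Finset.univ.filter fun x => Q x = c).card =
      Fintype.card V + (∑ x, ψ (Q x)) * ((if c = 0 then (Fintype.card K : ℂ) else 0) - 1) := by
  have h1 : (Fintype.card K : ℂ) * (Finset.univ.filter fun x => Q x = c).card =
      ∑ x, ∑ t, ψ (t * (Q x - c)) := by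
    simp_rw [sum_addChar_mul hψ, sub_eq_zero]
    rw [← Finset.sum_filter]
    simp [mul_comm]
  rw [h1, Finset.sum_comm, ← Finset.add_sum_erase _ _ (Finset.mem_univ (0 : K))]
  congr 1
  · simp
  · have h2 := sum_ne_zero_addChar_mul hψ (-c)
    simp only [neg_eq_zero] at h2
    rw [← h2, Finset.mul_sum]
    refine Finset.sum_congr rfl fun t ht => ?_
    rw [← sum_addChar_smul_quadratic hsim (Finset.ne_of_mem_erase ht), Finset.sum_mul]
    refine Finset.sum_congr rfl fun x _ => ?_
    rw [← AddChar.map_add_eq_mul]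
    congr 1
    ring

open Classical in
/-- The number of zeros of `Q` on an affine hyperplane `polar Q y x = ρ`, by detecting both
equations with characters, with frequencies `t` and `s`. The terms with `t = 0` contribute `|V|`. -/
lemma card_quadratic_eq_zero_polar_eq (hψ : ψ ≠ 1)
    (hQ : ∀ x, (∀ y, QuadraticMap.polar Q x y = 0) → x = 0)
    (hsim : ∀ t : K, t ≠ 0 → ∃ g : V ≃ V, ∀ x, Q (g x) = t * Q x)
    {y : V} (hy : y ≠ 0) (ρ : K) :
    (Fintype.card K : ℂ) ^ 2 *
        (Finset.univ.filter fun x => Q x = 0 ∧ QuadraticMap.polar Q y x = ρ).card =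
      Fintype.card V + (∑ x, ψ (Q x)) * Fintype.card K *
        (if Q y = 0 then (if ρ = 0 then (Fintype.card K : ℂ) - 1 else 0)
          else (if ρ = 0 then 0 else 1)) := by
  have h1 : (Fintype.card K : ℂ) ^ 2 *
      (Finset.univ.filter fun x => Q x = 0 ∧ QuadraticMap.polar Q y x = ρ).card =
      ∑ x, (∑ t, ψ (t * Q x)) * ∑ s, ψ (s * (QuadraticMap.polar Q y x - ρ)) := by
    simp_rw [sum_addChar_mul hψ, sub_eq_zero, ite_mul, zero_mul, mul_ite, mul_zero, ← ite_and]
    rw [← Finset.sum_filter]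
    simp [mul_comm, sq]
  have h2 : ∑ x, (∑ t, ψ (t * Q x)) * ∑ s, ψ (s * (QuadraticMap.polar Q y x - ρ)) =
      ∑ t, ∑ s, (∑ x, ψ (t * Q x + s * QuadraticMap.polar Q y x)) * ψ (s * -ρ) := by
    simp_rw [Finset.sum_mul_sum, Finset.sum_mul]
    rw [Finset.sum_comm]
    refine Finset.sum_congr rfl fun t _ => ?_
    rw [Finset.sum_comm]
    refine Finset.sum_congr rfl fun s _ => Finset.sum_congr rfl fun x _ => ?_
    rw [← AddChar.map_add_eq_mul, ← AddChar.map_add_eq_mul]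
    congr 1
    ring
  have hL : QuadraticMap.polarBilin Q y ≠ 0 := fun h => hy <| hQ y fun z => by
    simpa using DFunLike.congr_fun h z
  rw [h1, h2, ← Finset.add_sum_erase _ _ (Finset.mem_univ (0 : K))]
  congr 1
  · rw [Finset.sum_eq_single 0]
    · simp
    · intro s _ hs
      have := sum_addChar_linear hψ (s • QuadraticMap.polarBilin Q y)
      rw [if_neg (smul_ne_zero hs hL)] at this
      simp only [LinearMap.smul_apply, QuadraticMap.polarBilin_apply_apply, smul_eq_mul] at this
      simp [this]
    · simp
  · have h3 : ∑ t ∈ Finset.univ.erase 0, ∑ s,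
        (∑ x, ψ (t * Q x + s * QuadraticMap.polar Q y x)) * ψ (s * -ρ) =
        (∑ x, ψ (Q x)) * ∑ s, (∑ t ∈ Finset.univ.erase (0 : K), ψ (t * (-s ^ 2 * Q y)))
          * ψ (s * -ρ) := by
      -- Replacing `t` by `t⁻¹` makes the phase left by the completed square linear in `t`, so that
      -- no Gauss sum over `s` appears.
      have hinv : ∀ s : K, ∑ t ∈ Finset.univ.erase (0 : K), ψ (t * (-s ^ 2 * Q y)) =
          ∑ t ∈ Finset.univ.erase (0 : K), ψ (t⁻¹ * (-s ^ 2 * Q y)) := fun s =>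
        Finset.sum_nbij' (fun t => t⁻¹) (fun t => t⁻¹) (by simp) (by simp) (by simp) (by simp)
          (by simp)
      have hsq := fun (s t : K) (ht : t ∈ Finset.univ.erase (0 : K)) =>
        sum_addChar_smul_quadratic_add_polar (ψ := ψ) hsim (Finset.ne_of_mem_erase ht) s y
      generalize (∑ x, ψ (Q x)) = G at hsq ⊢
      rw [Finset.sum_comm, Finset.mul_sum]
      refine Finset.sum_congr rfl fun s _ => ?_
      rw [hinv, Finset.sum_mul, Finset.mul_sum]
      refine Finset.sum_congr rfl fun t ht => ?_
      rw [hsq s t ht, mul_assoc]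
    rw [h3, mul_assoc]
    congr 1
    simp_rw [sum_ne_zero_addChar_mul hψ]
    have h4 := sum_addChar_mul hψ (-ρ)
    simp only [neg_eq_zero] at h4
    by_cases hq : Q y = 0
    · simp only [hq, mul_zero, if_true]
      rw [← Finset.mul_sum, h4]
      split_ifs <;> ring
    · simp only [mul_eq_zero, hq, or_false, neg_eq_zero, ne_eq, OfNat.ofNat_ne_zero,
        not_false_eq_true, pow_eq_zero_iff, if_false, sub_mul, one_mul, Finset.sum_sub_distrib,
        h4]
      simp
      split_ifs <;> ring

end GaussSum

section Counts

variable {K V : Type*} [Field K] [Fintype K] [AddCommGroup V] [Module K V] [Fintype V]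
  {ψ : AddChar K ℂ} {Q : QuadraticForm K V} {q m : ℕ} {ε : ℤ}

open Classical in
lemma card_quadratic_eq_zero (hψ : ψ ≠ 1) (hK : Fintype.card K = q) (hm : 0 < m)
    (hV : Fintype.card V = q ^ (2 * m))
    (hsim : ∀ t : K, t ≠ 0 → ∃ g : V ≃ V, ∀ x, Q (g x) = t * Q x)
    (hG : ∑ x, ψ (Q x) = ε * (q : ℂ) ^ m) :
    ((Finset.univ.filter fun x => Q x = 0).card : ℤ) =
      q * (q ^ (m - 1)) ^ 2 + ε * (q - 1) * q ^ (m - 1) := by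
  obtain ⟨l, rfl⟩ := Nat.exists_eq_add_of_lt hm
  have hq : (q : ℤ) ≠ 0 := by rw [← hK]; exact_mod_cast Fintype.card_ne_zero
  have h := card_quadratic_eq hψ hsim 0
  rw [hK, hV, hG, if_pos rfl] at h
  apply mul_left_cancel₀ hq
  simp only [zero_add, Nat.add_sub_cancel] at h ⊢
  have h' : (q : ℤ) * (Finset.univ.filter fun x => Q x = 0).card =
    q ^ (2 * (l + 1)) + ε * q ^ (l + 1) * (q - 1) := by exact_mod_cast h
  rw [h']
  ring

open Classical in
lemma card_quadratic_zero_polar (hψ : ψ ≠ 1) (hK : Fintype.card K = q) (hm : 0 < m)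
    (hV : Fintype.card V = q ^ (2 * m))
    (hQ : ∀ x, (∀ y, QuadraticMap.polar Q x y = 0) → x = 0)
    (hsim : ∀ t : K, t ≠ 0 → ∃ g : V ≃ V, ∀ x, Q (g x) = t * Q x)
    (hG : ∑ x, ψ (Q x) = ε * (q : ℂ) ^ m) {y : V} (hy : y ≠ 0) (ρ : K) :
    ((Finset.univ.filter fun x => Q x = 0 ∧ QuadraticMap.polar Q y x = ρ).card : ℤ) =
      (q ^ (m - 1)) ^ 2 + ε * q ^ (m - 1) *
        (if Q y = 0 then (if ρ = 0 then (q : ℤ) - 1 else 0) else (if ρ = 0 then 0 else 1)) := by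
  obtain ⟨l, rfl⟩ := Nat.exists_eq_add_of_lt hm
  have hq : (q : ℤ) ^ 2 ≠ 0 := pow_ne_zero _ (by rw [← hK]; exact_mod_cast Fintype.card_ne_zero)
  have h := card_quadratic_eq_zero_polar_eq hψ hQ hsim hy ρ
  rw [hK, hV, hG] at h
  apply mul_left_cancel₀ hq
  simp only [zero_add, Nat.add_sub_cancel] at h ⊢
  have h' : (q : ℤ) ^ 2 *
      (Finset.univ.filter fun x => Q x = 0 ∧ QuadraticMap.polar Q y x = ρ).card =
    q ^ (2 * (l + 1)) + ε * q ^ (l + 1) * q *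
      (if Q y = 0 then (if ρ = 0 then (q : ℤ) - 1 else 0) else (if ρ = 0 then 0 else 1)) := by
    exact_mod_cast h
  rw [h']
  ring

end Counts

/-! ### Powers in cyclic groups and the arithmetic of `p ^ d + 1` -/

section Cyclic

variable {G : Type*} [CommGroup G] [IsCyclic G]

lemma exists_pow_eq_of_isCyclic {n N : ℕ} (hN : 0 < N) (hG : Nat.card G = n * N) {t : G}
    (ht : t ^ N = 1) : ∃ μ : G, μ ^ n = t := by
  obtain ⟨g, hg⟩ := IsCyclic.exists_generator (α := G)
  obtain ⟨i, rfl⟩ := Subgroup.mem_zpowers_iff.1 (hg t)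
  rw [← zpow_natCast, ← zpow_mul, ← orderOf_dvd_iff_zpow_eq_one,
    orderOf_eq_card_of_forall_mem_zpowers hg, hG, Nat.cast_mul] at ht
  obtain ⟨c, rfl⟩ := Int.dvd_of_mul_dvd_mul_right (by exact_mod_cast hN.ne') ht
  exact ⟨g ^ c, by rw [← zpow_natCast, ← zpow_mul, mul_comm]⟩

/-- A set of elements of a cyclic group that is a union of fibres of the `n`-th power map, that is,
of cosets of the subgroup of order `n`, has cardinality divisible by `n`. -/
lemma dvd_card_of_pow_invariant [Fintype G] [DecidableEq G] {n : ℕ} (hn : n ∣ Fintype.card G)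
    (S : Finset G) (hS : ∀ x y, x ^ n = y ^ n → x ∈ S → y ∈ S) : n ∣ S.card := by
  rw [Finset.card_eq_sum_card_image (fun x => x ^ n) S]
  refine Finset.dvd_sum fun z hz => ?_
  obtain ⟨x, hx, rfl⟩ := Finset.mem_image.1 hz
  have h1 : (S.filter fun y => y ^ n = x ^ n) =
      Finset.univ.filter fun y => powMonoidHom n y = x ^ n := by
    ext y
    simp only [Finset.mem_filter, Finset.mem_univ, true_and, powMonoidHom_apply,
      and_iff_right_iff_imp]
    exact fun h => hS x y h.symm hx
  rw [h1, MonoidHom.card_fiber_eq_of_mem_range (powMonoidHom n) (x := x ^ n) (y := 1) ⟨x, rfl⟩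
    ⟨1, by simp⟩]
  have h2 := IsCyclic.card_powMonoidHom_ker G n
  rw [Nat.card_eq_fintype_card (α := G), Nat.gcd_eq_right hn] at h2
  refine dvd_of_eq (h2.symm.trans ?_)
  rw [Nat.card_eq_fintype_card]
  exact Fintype.card_of_subtype _ (by simp [MonoidHom.mem_ker])

end Cyclic

section Arithmetic

/-- The cofactor `M` is `∑ i < s, p ^ (2 d i)`, a sum of `s` odd numbers. -/
lemma exists_factor_pow_sub_one {p : ℕ} (hp : Odd p) (R : Type*) [CommRing R] (d s : ℕ) :
    ∃ M : ℕ, p ^ (2 * d * s) - 1 = (p ^ d + 1) * ((p ^ d - 1) * M) ∧ (-1 : R) ^ M = (-1) ^ s := by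
  have hpos : 0 < p := hp.pos
  refine ⟨∑ i ∈ Finset.range s, (p ^ (2 * d)) ^ i, ?_, ?_⟩
  · obtain ⟨x, hx⟩ : ∃ x, p ^ (2 * d) = x + 1 :=
      Nat.exists_eq_add_one.2 (pow_pos hpos _)
    obtain ⟨y, hy⟩ : ∃ y, p ^ d = y + 1 := Nat.exists_eq_add_one.2 (pow_pos hpos _)
    have h1 := geom_sum_mul_add x s
    rw [pow_mul, hx, ← h1, hy, Nat.add_sub_cancel, Nat.add_sub_cancel]
    have h2 : x = (y + 1 + 1) * y := by
      rw [mul_comm 2, pow_mul, hy] at hx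
      linarith [show (y + 1) ^ 2 = (y + 1 + 1) * y + 1 by ring]
    generalize ∑ i ∈ Finset.range s, (x + 1) ^ i = M
    rw [h2]
    ring
  · rw [← Finset.prod_pow_eq_pow_sum]
    simp [(hp.pow.pow : Odd ((p ^ (2 * d)) ^ _)).neg_one_pow]

variable {R : Type*} [Monoid R] {y : R} {p : ℕ}

lemma pow_pow_eq_of_odd {d j : ℕ} (hj : Odd j) (hy : y ^ p ^ (2 * d) = y) :
    y ^ p ^ (d * j) = y ^ p ^ d := by
  obtain ⟨i, rfl⟩ := hj
  induction i with
  | zero => simp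
  | succ i ih =>
    rw [show d * (2 * (i + 1) + 1) = 2 * d + d * (2 * i + 1) by ring, pow_add, pow_mul, hy, ih]

lemma pow_pow_gcd {m n : ℕ} (hm : y ^ p ^ m = y) (hn : y ^ p ^ n = y) :
    y ^ p ^ Nat.gcd m n = y := by
  have h : ∀ n, Function.IsPeriodicPt (fun x : R => x ^ p) n y ↔ y ^ p ^ n = y := fun n => by
    rw [Function.IsPeriodicPt, Function.IsFixedPt, pow_iterate]
  exact (h _).1 (((h _).2 hm).gcd ((h _).2 hn))

end Arithmetic

/-! ### The quadratic form `Tr (a x ^ (p ^ k + 1))` -/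

section FrobeniusForm

variable (p : ℕ) [Fact p.Prime] {F : Type*} [Field F] [Fintype F] [Algebra (ZMod p) F]

/-- The quadratic form `x ↦ Tr (a x ^ (p ^ k + 1))`, given by the bilinear form
`Tr (a x ^ (p ^ k) y)`. -/
def frobeniusForm (k : ℕ) (a : F) : QuadraticForm (ZMod p) F :=
  LinearMap.BilinMap.toQuadraticMap
    ((Algebra.traceForm (ZMod p) F).compl₁₂
      (LinearMap.mulLeft (ZMod p) a ∘ₗ
        ((FiniteField.frobeniusAlgEquivOfAlgebraic (ZMod p) F) ^ k).toLinearMap) LinearMap.id)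

variable {p} {k : ℕ} {a : F}

lemma frobenius_pow_apply (x : F) :
    (FiniteField.frobeniusAlgEquivOfAlgebraic (ZMod p) F ^ k) x = x ^ p ^ k := by
  rw [AlgEquiv.coe_pow, FiniteField.coe_frobeniusAlgEquivOfAlgebraic_iterate, ZMod.card]

lemma trace_pow_pow (x : F) :
    Algebra.trace (ZMod p) F (x ^ p ^ k) = Algebra.trace (ZMod p) F x := by
  rw [← frobenius_pow_apply, Algebra.trace_eq_of_algEquiv]

lemma frobeniusForm_apply (x : F) :
    frobeniusForm p k a x = Algebra.trace (ZMod p) F (a * x ^ (p ^ k + 1)) := by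
  simp [frobeniusForm, FiniteField.coe_frobeniusAlgEquivOfAlgebraic_iterate, pow_succ, mul_assoc]

lemma polar_frobeniusForm (x y : F) :
    QuadraticMap.polar (frobeniusForm p k a) x y =
      Algebra.trace (ZMod p) F (a * x ^ p ^ k * y) +
        Algebra.trace (ZMod p) F (a * y ^ p ^ k * x) := by
  rw [frobeniusForm, LinearMap.BilinMap.polar_toQuadraticMap]
  simp [FiniteField.coe_frobeniusAlgEquivOfAlgebraic_iterate]

/-- For `x` in the radical, moving the Frobenius power to one side of the trace form gives
`(a x ^ (p ^ k)) ^ (p ^ k) = -a x`; multiply by `x ^ (p ^ k)`. -/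
lemma eq_of_radical {x : F} (hx : ∀ y, QuadraticMap.polar (frobeniusForm p k a) x y = 0) :
    (a * x ^ (p ^ k + 1)) ^ p ^ k = -(a * x ^ (p ^ k + 1)) := by
  have h1 : ∀ z, Algebra.traceForm (ZMod p) F ((a * x ^ p ^ k) ^ p ^ k + a * x) z = 0 := by
    intro z
    obtain ⟨y, rfl⟩ := (FiniteField.frobeniusAlgEquivOfAlgebraic (ZMod p) F ^ k).surjective z
    rw [frobenius_pow_apply, Algebra.traceForm_apply, add_mul, map_add, ← mul_pow, trace_pow_pow,
      ← hx y, polar_frobeniusForm]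
    ring_nf
  have h2 := (traceForm_nondegenerate (ZMod p) F).1 _ h1
  have h3 : (a * x ^ (p ^ k + 1)) ^ p ^ k = (a * x ^ p ^ k) ^ p ^ k * x ^ p ^ k := by
    rw [← mul_pow]; ring
  rw [h3, eq_neg_of_add_eq_zero_left h2]
  ring

variable {d e j s : ℕ}

/-- The form is nondegenerate: an element `x ≠ 0` of the radical gives `y = a x ^ (p ^ k + 1)` with
`y ^ (p ^ d) = -y`, and this forces `a ^ ((q - 1) / (p ^ d + 1)) = (-1) ^ s`. -/
lemma frobeniusForm_nondegenerate (hp : Odd p) (hF : Fintype.card F = p ^ e)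
    (he : e = 2 * d * s) (hk : k = d * j) (hj : Odd j) (hjs : Nat.Coprime j s)
    (ha : a ≠ 0) (has : a ^ ((p ^ e - 1) / (p ^ d + 1)) ≠ (-1 : F) ^ s)
    (x : F) (hx : ∀ y, QuadraticMap.polar (frobeniusForm p k a) x y = 0) : x = 0 := by
  by_contra hx0
  apply has
  obtain ⟨M, hM, hsign⟩ := exists_factor_pow_sub_one hp F d s
  rw [← he] at hM
  rw [hM, Nat.mul_div_cancel_left _ (Nat.succ_pos _)]
  have hy := eq_of_radical hx
  set y := a * x ^ (p ^ k + 1) with hydef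
  have hy0 : y ≠ 0 := mul_ne_zero ha (pow_ne_zero _ hx0)
  have hk2 : y ^ p ^ (2 * k) = y := by
    rw [two_mul, pow_add, pow_mul, hy, hp.pow.neg_pow, hy, neg_neg]
  have he2 : y ^ p ^ e = y := by rw [← hF, FiniteField.pow_card]
  have hgcd : Nat.gcd (2 * k) e = 2 * d := by
    rw [hk, he, ← mul_assoc, Nat.gcd_mul_left, hjs.gcd_eq_one, mul_one]
  have hd2 : y ^ p ^ (2 * d) = y := hgcd ▸ pow_pow_gcd hk2 he2
  -- As `y` lies in the field with `p ^ (2 d)` elements and `k / d` is odd, `y ^ p ^ k = y ^ p ^ d`.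
  have hyd : y ^ (p ^ d - 1) = -1 := by
    have h := pow_pow_eq_of_odd hj hd2
    rw [← hk, hy] at h
    apply mul_right_cancel₀ hy0
    rw [← pow_succ, Nat.sub_add_cancel (pow_pos hp.pos d), ← h, neg_one_mul]
  obtain ⟨c, hc⟩ : p ^ d + 1 ∣ p ^ k + 1 := by
    rw [hk, pow_mul]
    simpa using hj.nat_add_dvd_pow_add_pow (p ^ d) 1
  have hx1 : (x ^ (p ^ k + 1)) ^ ((p ^ d - 1) * M) = 1 := by
    rw [← pow_mul, hc, mul_right_comm, ← hM, pow_mul, ← hF,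
      FiniteField.pow_card_sub_one_eq_one x hx0, one_pow]
  calc a ^ ((p ^ d - 1) * M) = y ^ ((p ^ d - 1) * M) := by rw [hydef, mul_pow, hx1, mul_one]
    _ = (-1) ^ s := by rw [pow_mul, hyd, hsign]

/-- Every nonzero multiple of the form is equivalent to it: scaling `x` by `μ` multiplies the form
by `μ ^ (p ^ k + 1)`, and every `t ≠ 0` in the prime field is of this shape. -/
lemma frobeniusForm_similitude (hp : Odd p)   (hF : Fintype.card F = p ^ e)
    (he : e = 2 * d * s) (hk : k = d * j) (hj : Odd j) (t : ZMod p) (ht : t ≠ 0) :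
    ∃ g : F ≃ F, ∀ x, frobeniusForm p k a (g x) = t * frobeniusForm p k a x := by
  classical
  obtain ⟨M, hM, -⟩ := exists_factor_pow_sub_one hp F d s
  rw [← he] at hM
  have hp1 : 1 < p := (Fact.out : p.Prime).one_lt
  have hcard : Nat.card Fˣ = (p ^ d + 1) * ((p ^ d - 1) * M) := by
    rw [Nat.card_eq_fintype_card, Fintype.card_units, hF, hM]
  have hN : 0 < (p ^ d - 1) * M := by
    refine Nat.pos_of_ne_zero fun h => ?_
    rw [h, mul_zero] at hcard
    exact Nat.card_pos.ne' hcard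
  have htd : algebraMap (ZMod p) F t ^ (p ^ d - 1) = 1 := by
    obtain ⟨c, hc⟩ : p - 1 ∣ p ^ d - 1 := by simpa using Nat.sub_dvd_pow_sub_pow p 1 d
    rw [hc, pow_mul, ← map_pow, ZMod.pow_card_sub_one_eq_one ht, map_one, one_pow]
  have ht' : algebraMap (ZMod p) F t ≠ 0 := by simpa using ht
  obtain ⟨μ, hμ⟩ := exists_pow_eq_of_isCyclic hN hcard (t := Units.mk0 _ ht') (by
    ext
    simp [pow_mul, htd])
  have hμ1 : (μ : F) ^ (p ^ d + 1) = algebraMap (ZMod p) F t := by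
    simpa using congrArg Units.val hμ
  -- `μ` lies in the field with `p ^ (2 d)` elements, so `μ ^ p ^ k = μ ^ p ^ d`.
  have hμ2 : (μ : F) ^ p ^ (2 * d) = μ := by
    have h : p ^ (2 * d) = (p ^ d + 1) * (p ^ d - 1) + 1 := by
      obtain ⟨y, hy⟩ : ∃ y, p ^ d = y + 1 := Nat.exists_eq_add_one.2 (pow_pos hp.pos _)
      rw [mul_comm 2, pow_mul, hy, Nat.add_sub_cancel]
      ring
    rw [h, pow_succ, pow_mul, hμ1, htd, one_mul]
  have hμ3 : (μ : F) ^ (p ^ k + 1) = algebraMap (ZMod p) F t := by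
    rw [← hμ1, hk, pow_succ, pow_succ, pow_pow_eq_of_odd hj hμ2]
  refine ⟨μ.mulLeft, fun x => ?_⟩
  rw [frobeniusForm_apply, frobeniusForm_apply, Units.mulLeft_apply, mul_pow, hμ3, mul_left_comm,
    ← Algebra.smul_def, map_smul, smul_eq_mul]

open Classical in
/-- The `(p ^ d + 1)`-th roots of unity act freely on the nonzero level sets of the form. -/
lemma dvd_card_frobeniusForm_eq (hp : Odd p) (hF : Fintype.card F = p ^ e)
    (he : e = 2 * d * s) (hk : k = d * j) (hj : Odd j) {c : ZMod p} (hc : c ≠ 0) :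
    p ^ d + 1 ∣ (Finset.univ.filter fun x => frobeniusForm p k a x = c).card := by
  obtain ⟨M, hM, -⟩ := exists_factor_pow_sub_one hp F d s
  rw [← he] at hM
  obtain ⟨i, hi⟩ : p ^ d + 1 ∣ p ^ k + 1 := by
    rw [hk, pow_mul]
    simpa using hj.nat_add_dvd_pow_add_pow (p ^ d) 1
  have h1 : (Finset.univ.filter fun x => frobeniusForm p k a x = c) =
      (Finset.univ.filter fun x : Fˣ => frobeniusForm p k a x = c).map
        ⟨Units.val, Units.val_injective⟩ := by
    ext x
    simp only [Finset.mem_filter, Finset.mem_univ, true_and, Finset.mem_map,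
      Function.Embedding.coeFn_mk]
    constructor
    · intro h
      have hx : x ≠ 0 := by
        rintro rfl
        exact hc (by simpa using h.symm)
      exact ⟨Units.mk0 x hx, h, rfl⟩
    · rintro ⟨y, h, rfl⟩
      exact h
  rw [h1, Finset.card_map]
  refine dvd_card_of_pow_invariant ?_ _ fun x y hxy hx => ?_
  · rw [Fintype.card_units, hF, hM]
    exact dvd_mul_right _ _
  · simp only [Finset.mem_filter, Finset.mem_univ, true_and] at hx ⊢
    have hxy' : (x : F) ^ (p ^ d + 1) = (y : F) ^ (p ^ d + 1) := by
      simpa using congrArg Units.val hxy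
    rw [← hx, frobeniusForm_apply, frobeniusForm_apply, hi, pow_mul, pow_mul, hxy']

end FrobeniusForm

section Sign

variable {p : ℕ} [Fact p.Prime] {F : Type*} [Field F] [Fintype F] [Algebra (ZMod p) F]
  {k : ℕ} {a : F} {d e j m s : ℕ}

/-- The exponential sum of the form is the rational integer `q - p N`, where `N` is the number of
solutions of `Tr (a x ^ (p ^ k + 1)) = 1`. Its square is `q = p ^ (2 m)`, and its sign is determined
by the divisibility of `N` by `p ^ d + 1`, as `p ^ m ≡ (-1) ^ s` modulo `p ^ d + 1`. -/
lemma sum_addChar_frobeniusForm {ψ : AddChar (ZMod p) ℂ} (hψ : ψ ≠ 1) (hp : Odd p) (hd : 0 < d)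
    (hF : Fintype.card F = p ^ e) (he : e = 2 * d * s) (hm : m = d * s) (hk : k = d * j)
    (hj : Odd j) (hjs : Nat.Coprime j s) (ha : a ≠ 0)
    (has : a ^ ((p ^ e - 1) / (p ^ d + 1)) ≠ (-1 : F) ^ s) :
    ∑ x, ψ (frobeniusForm p k a x) = ((-1 : ℤ) ^ s : ℤ) * (p : ℂ) ^ m := by
  have hQ := frobeniusForm_nondegenerate hp hF he hk hj hjs ha has
  have hsim := frobeniusForm_similitude (a := a) hp hF he hk hj
  obtain ⟨c, hc⟩ := dvd_card_frobeniusForm_eq (a := a) hp hF he hk hj (one_ne_zero (α := ZMod p))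
  have h1 := card_quadratic_eq hψ hsim 1
  have h2 := sum_addChar_quadratic_mul_neg hψ hQ
  have h3 := sum_addChar_smul_quadratic (ψ := ψ) hsim (neg_ne_zero.2 one_ne_zero)
  simp only [neg_one_mul] at h3
  rw [h3, hF] at h2
  rw [ZMod.card, hF, if_neg one_ne_zero, hc] at h1
  generalize ∑ x, ψ (frobeniusForm p k a x) = G at h1 h2 ⊢
  have hG : G = (((p : ℤ) ^ e - p * ((p ^ d + 1) * c) : ℤ) : ℂ) := by
    push_cast at h1 ⊢
    linear_combination h1
  set g : ℤ := (p : ℤ) ^ e - p * ((p ^ d + 1) * c) with hg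
  have hg2 : g ^ 2 = ((p : ℤ) ^ m) ^ 2 := by
    rw [hG] at h2
    have : g * g = (p : ℤ) ^ e := by exact_mod_cast h2
    rw [sq, this, hm, he]
    ring
  have hpm : (p : ℤ) ^ m ≡ (-1) ^ s [ZMOD p ^ d + 1] := by
    rw [hm, pow_mul]
    exact Int.ModEq.pow _ (Int.modEq_iff_dvd.2 ⟨-1, by ring⟩)
  have hsgn : ((-1 : ℤ) ^ s) * (-1) ^ s = 1 := by rw [← mul_pow]; simp
  have hgm : g ≡ 1 [ZMOD p ^ d + 1] := by
    have h4 : (p : ℤ) ^ e ≡ 1 [ZMOD p ^ d + 1] := by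
      have := hpm.mul hpm
      rwa [hsgn, ← pow_add, show m + m = e by rw [hm, he]; ring] at this
    refine Int.ModEq.trans (Int.modEq_iff_dvd.2 ⟨p * c, ?_⟩) h4
    rw [hg]; ring
  have hgoal : g = (-1) ^ s * (p : ℤ) ^ m := by
    have hcases : g = (-1) ^ s * (p : ℤ) ^ m ∨ g = -((-1) ^ s * (p : ℤ) ^ m) := by
      rcases sq_eq_sq_iff_eq_or_eq_neg.1 hg2 with h | h <;>
        rcases neg_one_pow_eq_or ℤ s with h' | h' <;> simp [h, h']
    -- The wrong sign gives `g ≡ -1`, so `p ^ d + 1` divides `2`.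
    refine hcases.resolve_right fun h => ?_
    have h5 : g ≡ -1 [ZMOD p ^ d + 1] := by
      have := (hpm.mul_left ((-1) ^ s)).neg
      rwa [hsgn, ← h] at this
    have h6 : ((p : ℤ) ^ d + 1) ∣ 2 := by
      simpa using (hgm.symm.trans h5).symm.dvd
    have h7 := Int.le_of_dvd two_pos h6
    have h8 : (p : ℤ) ≤ (p : ℤ) ^ d :=
      le_self_pow₀ (by exact_mod_cast (Fact.out : p.Prime).one_lt.le) hd.ne'
    have h9 : (2 : ℤ) ≤ p := by exact_mod_cast (Fact.out : p.Prime).two_le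
    linarith
  rw [hG, hgoal]
  push_cast
  rfl

end Sign

/-! ### Enumerators of a code given by an injective encoding -/

section RangeCode

variable {K V ι : Type*} [Field K] [AddCommGroup V] [Module K V] [Fintype V]
  [Fintype ι] {E : V →ₗ[K] (ι → K)}

open Classical in
lemma weightCount_range (hE : Function.Injective E) (i : ℕ) :
    weightCount (LinearMap.range E) i =
      (Finset.univ.filter fun y => hammingNorm (E y) = i).card := by
  rw [weightCount, ← Set.ncard_coe_finset, ← Set.ncard_image_of_injective _ hE]
  congr 1
  ext c
  simp only [LinearMap.mem_range, Set.mem_ofPred_eq, Finset.coe_filter, Finset.mem_univ, true_and,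
    Set.mem_image]
  constructor
  · rintro ⟨⟨y, rfl⟩, h⟩
    exact ⟨y, h, rfl⟩
  · rintro ⟨y, h, rfl⟩
    exact ⟨⟨y, rfl⟩, h⟩

open Classical in
lemma weightEnumerator_range (hE : Function.Injective E) :
    weightEnumerator (LinearMap.range E) = ∑ y, (Polynomial.X : ℤ[X]) ^ hammingNorm (E y) := by
  have h0 : ∀ y, hammingNorm (E y) = 0 ↔ y = 0 := fun y => by
    rw [hammingNorm_eq_zero, map_eq_zero_iff E hE]
  rw [weightEnumerator, ← Finset.sum_fiberwise_of_maps_to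
    (t := Finset.range (Fintype.card ι + 1)) (g := fun y => hammingNorm (E y))
    (fun y _ => Finset.mem_range.2 (Nat.lt_succ_of_le hammingNorm_le_card_fintype)),
    Finset.range_eq_Ico, Finset.sum_eq_sum_Ico_succ_bot (Nat.succ_pos _)]
  congr 1
  · rw [Finset.sum_eq_single_of_mem 0 (by simp)]
    · simp
    · intro y hy hy0
      exact absurd ((h0 y).1 (Finset.mem_filter.1 hy).2) hy0
  · refine Finset.sum_congr (by ext; simp) fun i _ => ?_
    rw [weightCount_range hE, Finset.sum_congr rfl (g := fun _ => Polynomial.X ^ i)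
      (fun y hy => by rw [(Finset.mem_filter.1 hy).2])]
    simp

variable [Fintype K]

lemma completeWeightEnumerator_range (hE : Function.Injective E) :
    completeWeightEnumerator (LinearMap.range E) = ∑ y, wordCWE (E y) := by
  rw [completeWeightEnumerator]
  refine Eq.trans (Finset.sum_congr ?_ fun _ _ => rfl) (Finset.sum_map Finset.univ ⟨E, hE⟩ wordCWE)
  ext c
  simp

open Classical in
lemma hammingNorm_eq_sum_symbolCount (c : ι → K) :
    hammingNorm c = ∑ ρ ∈ Finset.univ.erase 0, symbolCount c ρ := by
  rw [hammingNorm, Finset.card_eq_sum_card_fiberwise (f := c) (t := Finset.univ.erase 0)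
    (by intro i; simp)]
  refine Finset.sum_congr rfl fun ρ hρ => ?_
  rw [symbolCount, Finset.filter_filter]
  congr 1
  ext i
  have := Finset.ne_of_mem_erase hρ
  simp only [Finset.mem_filter, Finset.mem_univ, true_and, and_iff_right_iff_imp]
  rintro rfl
  exact this

open Classical in
lemma hammingNorm_of_symbolCount {c : ι → K} {w : ℕ} (hc : ∀ ρ ≠ 0, symbolCount c ρ = w) :
    hammingNorm c = (Fintype.card K - 1) * w := by
  rw [hammingNorm_eq_sum_symbolCount,
    Finset.sum_congr rfl fun ρ hρ => hc ρ (Finset.ne_of_mem_erase hρ)]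
  simp

lemma wordCWE_of_symbolCount [DecidableEq K] {c : ι → K} {w : ℕ}
    (hc : ∀ ρ ≠ 0, symbolCount c ρ = w) :
    wordCWE c = MvPolynomial.X 0 ^ symbolCount c 0 *
      ∏ ρ ∈ Finset.univ.erase (0 : K), MvPolynomial.X ρ ^ w := by
  rw [wordCWE, ← Finset.mul_prod_erase _ _ (Finset.mem_univ (0 : K)),
    Finset.prod_congr rfl fun ρ hρ => by rw [hc ρ (Finset.ne_of_mem_erase hρ)]]

end RangeCode

/-! ### The code of a quadratic form on its nonzero zeros -/

section PolarCode

variable {K V : Type*} [Field K] [AddCommGroup V] [Module K V]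

/-- The encoding map `y ↦ (polar Q y x)_{x ∈ D}`. -/
def polarEncode (Q : QuadraticForm K V) (D : Finset V) : V →ₗ[K] (D → K) :=
  LinearMap.pi fun x => (QuadraticMap.polarBilin Q).flip x

variable {Q : QuadraticForm K V} {D : Finset V}

lemma polarEncode_apply (y : V) (x : D) : polarEncode Q D y x = QuadraticMap.polar Q y x := by
  simp [polarEncode]

variable [Fintype V]

open Classical in
/-- The word of `y` at the nonzero zeros of `Q`: only the letter `0` sees that the zero vector has
been left out. -/
lemma symbolCount_polarEncode (hD : ∀ x, x ∈ D ↔ x ≠ 0 ∧ Q x = 0) (y : V) (ρ : K) :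
    symbolCount (polarEncode Q D y) ρ + (if ρ = 0 then 1 else 0) =
      (Finset.univ.filter fun x => Q x = 0 ∧ QuadraticMap.polar Q y x = ρ).card := by
  have h1 : symbolCount (polarEncode Q D y) ρ =
      ((Finset.univ.filter fun x => Q x = 0 ∧ QuadraticMap.polar Q y x = ρ).erase 0).card := by
    rw [symbolCount, ← Finset.card_map (Function.Embedding.subtype _)]
    congr 1
    ext x
    simp only [polarEncode_apply, Finset.mem_map, Finset.mem_filter, Finset.mem_univ, true_and,
      Function.Embedding.coe_subtype, Finset.mem_erase]
    constructor
    · rintro ⟨z, hz, rfl⟩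
      exact ⟨((hD z).1 z.2).1, ((hD z).1 z.2).2, hz⟩
    · rintro ⟨h0, hx, hρ⟩
      exact ⟨⟨x, (hD x).2 ⟨h0, hx⟩⟩, hρ, rfl⟩
  rw [h1]
  split_ifs with h
  · exact Finset.card_erase_add_one (by simp [h])
  · rw [Finset.erase_eq_of_notMem (by simp [Ne.symm h]), add_zero]

open Classical in
/-- Summation over `V` according to the three classes `y = 0`, `y ≠ 0` with `Q y = 0`, and
`Q y ≠ 0`. -/
lemma sum_of_quadratic_classes {R : Type*} [CommRing R] {f : V → R} {A B C : R} {N M : ℤ}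
    (hN : ((Finset.univ.filter fun x => Q x = 0).card : ℤ) = N + 1)
    (hM : (Fintype.card V : ℤ) = N + 1 + M)
    (hA : f 0 = A) (hB : ∀ y, y ≠ 0 → Q y = 0 → f y = B) (hC : ∀ y, Q y ≠ 0 → f y = C) :
    ∑ y, f y = A + N * B + M * C := by
  have h0 : (0 : V) ∈ Finset.univ.filter fun x => Q x = 0 := by simp
  have hM' : ((Finset.univ.filter fun x => ¬ Q x = 0).card : ℤ) = M := by
    have := Finset.card_filter_add_card_filter_not (s := (Finset.univ : Finset V))
      (fun x => Q x = 0)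
    rw [Finset.card_univ] at this
    have : ((Finset.univ.filter fun x => Q x = 0).card : ℤ) +
      (Finset.univ.filter fun x => ¬ Q x = 0).card = Fintype.card V := by exact_mod_cast this
    linarith
  have hN' : (((Finset.univ.filter fun x => Q x = 0).erase 0).card : ℤ) = N := by
    have := Finset.card_erase_add_one h0
    have : (((Finset.univ.filter fun x => Q x = 0).erase 0).card : ℤ) + 1 =
      (Finset.univ.filter fun x => Q x = 0).card := by exact_mod_cast this
    linarith
  rw [← Finset.sum_filter_add_sum_filter_not Finset.univ (fun x => Q x = 0),
    ← Finset.add_sum_erase _ _ h0, hA,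
    Finset.sum_congr rfl (g := fun _ => B) fun y hy => hB y (Finset.ne_of_mem_erase hy)
      (Finset.mem_filter.1 (Finset.mem_of_mem_erase hy)).2,
    Finset.sum_congr rfl (g := fun _ => C) fun y hy => hC y (Finset.mem_filter.1 hy).2,
    Finset.sum_const, Finset.sum_const, nsmul_eq_mul, nsmul_eq_mul, ← Int.cast_natCast, hN',
    ← Int.cast_natCast, hM']

/-- Positivity of the parameters of the code; here `P` stands for `q ^ (m - 1)`. The
bound `q ≤ P` holds because `m > 1`. -/
lemma polarCode_numbers_pos {q P ε : ℤ} (hq : 3 ≤ q) (hP : q ≤ P) (hε : ε = 1 ∨ ε = -1) :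
    0 ≤ P ^ 2 + ε * (q - 1) * P - 1 ∧ 0 < P ^ 2 + ε * P ∧ P ^ 2 + ε * P ≠ P ^ 2 ∧
      0 < q * P ^ 2 + ε * (q - 1) * P - 1 ∧ 0 < (q - 1) * (q * P ^ 2 - ε * P) := by
  have h1 : q * P ≤ P ^ 2 := by nlinarith
  have h2 : 3 * P ≤ q * P := by nlinarith
  have h3 : 3 * P ^ 2 ≤ q * P ^ 2 := by nlinarith
  rcases hε with rfl | rfl
  · refine ⟨?_, ?_, ?_, ?_, mul_pos (by linarith) ?_⟩
    · linarith
    · linarith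
    · intro h; linarith
    · linarith
    · linarith
  · refine ⟨?_, ?_, ?_, ?_, mul_pos (by linarith) ?_⟩
    · linarith
    · linarith
    · intro h; linarith
    · linarith
    · linarith

open Classical in
/-- The parameters and both enumerators of the code of `Q` on its nonzero zeros, from the number of
zeros of `Q` in `V` and on the hyperplanes `polar Q y x = ρ`. The sign `ε` is `1` for
a hyperbolic and `-1` for an elliptic form. -/
lemma polarCode_enumerators [Fintype K] {q m : ℕ} {ε : ℤ}
    (hK : Fintype.card K = q) (hq : 3 ≤ q) (hm : 1 < m) (hV : Fintype.card V = q ^ (2 * m))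
    (hε : ε = 1 ∨ ε = -1)
    (h0 : ((Finset.univ.filter fun x => Q x = 0).card : ℤ) =
      q * (q ^ (m - 1)) ^ 2 + ε * (q - 1) * q ^ (m - 1))
    (hpol : ∀ y ≠ 0, ∀ ρ,
      ((Finset.univ.filter fun x => Q x = 0 ∧ QuadraticMap.polar Q y x = ρ).card : ℤ) =
      (q ^ (m - 1)) ^ 2 + ε * q ^ (m - 1) *
        (if Q y = 0 then (if ρ = 0 then (q : ℤ) - 1 else 0) else (if ρ = 0 then 0 else 1)))
    (hD : ∀ x, x ∈ D ↔ x ≠ 0 ∧ Q x = 0) :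
    ∃ n u v : ℕ,
      (n : ℤ) = (q : ℤ) ^ (2 * m - 1) + ε * ((q : ℤ) - 1) * (q : ℤ) ^ (m - 1) - 1 ∧
      (u : ℤ) = (q : ℤ) ^ (2 * m - 2) + ε * ((q : ℤ) - 1) * (q : ℤ) ^ (m - 1) - 1 ∧
      (v : ℤ) = (q : ℤ) ^ (2 * m - 2) + ε * (q : ℤ) ^ (m - 1) ∧
      D.card = n ∧
      Module.finrank K (LinearMap.range (polarEncode Q D)) = 2 * m ∧
      IsTWeight 2 (LinearMap.range (polarEncode Q D)) ∧
      weightEnumerator (LinearMap.range (polarEncode Q D)) =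
        1 + Polynomial.C ((q : ℤ) ^ (2 * m - 1) + ε * ((q : ℤ) - 1) * (q : ℤ) ^ (m - 1) - 1)
              * Polynomial.X ^ ((q - 1) * q ^ (2 * m - 2))
          + Polynomial.C (((q : ℤ) - 1) * ((q : ℤ) ^ (2 * m - 1) - ε * (q : ℤ) ^ (m - 1)))
              * Polynomial.X ^ ((q - 1) * v) ∧
      completeWeightEnumerator (LinearMap.range (polarEncode Q D)) =
        MvPolynomial.X (0 : K) ^ n
          + MvPolynomial.C
                ((q : ℤ) ^ (2 * m - 1) + ε * ((q : ℤ) - 1) * (q : ℤ) ^ (m - 1) - 1)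
              * MvPolynomial.X (0 : K) ^ u
              * ∏ ρ ∈ Finset.univ.erase (0 : K), MvPolynomial.X ρ ^ (q ^ (2 * m - 2))
          + MvPolynomial.C
                (((q : ℤ) - 1) * ((q : ℤ) ^ (2 * m - 1) - ε * (q : ℤ) ^ (m - 1)))
              * MvPolynomial.X (0 : K) ^ (q ^ (2 * m - 2) - 1)
              * ∏ ρ ∈ Finset.univ.erase (0 : K), MvPolynomial.X ρ ^ v := by
  obtain ⟨l, rfl⟩ := Nat.exists_eq_add_of_lt hm
  simp only [show 2 * (1 + l + 1) - 1 = 2 * (l + 1) + 1 by omega,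
    show 2 * (1 + l + 1) - 2 = 2 * (l + 1) by omega,
    show 1 + l + 1 - 1 = l + 1 by omega] at h0 hpol ⊢
  have e1 : (q : ℤ) ^ (2 * (l + 1)) = ((q : ℤ) ^ (l + 1)) ^ 2 := by ring
  have e2 : (q : ℤ) ^ (2 * (l + 1) + 1) = q * ((q : ℤ) ^ (l + 1)) ^ 2 := by ring
  have e3 : (Fintype.card V : ℤ) = q ^ 2 * ((q : ℤ) ^ (l + 1)) ^ 2 := by
    rw [hV]; push_cast; ring
  have hq' : (3 : ℤ) ≤ q := by exact_mod_cast hq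
  have hP : (q : ℤ) ≤ (q : ℤ) ^ (l + 1) := le_self_pow₀ (by linarith) (by omega)
  rw [e1, e2]
  generalize hPdef : (q : ℤ) ^ (l + 1) = P at *
  -- An opaque name for the natural number `q ^ (2 m - 2)`, whose cast is `P ^ 2`.
  obtain ⟨W, hW⟩ : ∃ W : ℕ, W = q ^ (2 * (l + 1)) := ⟨_, rfl⟩
  have hWP : (W : ℤ) = P ^ 2 := by rw [hW]; push_cast; exact e1
  rw [← hW]
  obtain ⟨hu0, hv0', hvP, hN0', hM0'⟩ := polarCode_numbers_pos hq' hP hε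
  obtain ⟨u, hu⟩ := Int.eq_ofNat_of_zero_le hu0
  obtain ⟨v, hv⟩ := Int.eq_ofNat_of_zero_le hv0'.le
  have hv0 : 0 < v := by
    rw [hv] at hv0'
    exact_mod_cast hv0'
  have hvW : v ≠ W := by
    rintro rfl
    exact hvP (hv.trans hWP)
  have hW0 : 0 < W := by
    have : (0 : ℤ) < W := by rw [hWP]; exact pow_pos (by linarith) 2
    exact_mod_cast this
  -- `N` and `M` count the `y ≠ 0` with `Q y = 0` and the `y` with `Q y ≠ 0`.
  obtain ⟨N, hN⟩ : ∃ N, N = q * P ^ 2 + ε * (q - 1) * P - 1 := ⟨_, rfl⟩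
  obtain ⟨M, hM⟩ : ∃ M, M = (q - 1) * (q * P ^ 2 - ε * P) := ⟨_, rfl⟩
  have hN0 : 0 < N := hN ▸ hN0'
  have hM0 : 0 < M := hM ▸ hM0'
  rw [← hN, ← hM]
  have hcN : ((Finset.univ.filter fun x => Q x = 0).card : ℤ) = N + 1 := by rw [h0, hN]; ring
  have hcM : (Fintype.card V : ℤ) = N + 1 + M := by rw [e3, hN, hM]; ring
  have hDcard : (D.card : ℤ) = N := by
    have h : D = (Finset.univ.filter fun x => Q x = 0).erase 0 := by
      ext x
      simp [hD]
    have h' := Finset.card_erase_add_one (s := Finset.univ.filter fun x => Q x = 0) (a := 0)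
      (by simp)
    rw [← h] at h'
    have : (D.card : ℤ) + 1 = (Finset.univ.filter fun x => Q x = 0).card := by exact_mod_cast h'
    linarith
  -- The symbol counts of the three kinds of codewords: `A` for `y = 0`, `B` for the other zeros
  -- of `Q`, `C` for `Q y ≠ 0`.
  have hsc : ∀ y ≠ 0, ∀ ρ, (symbolCount (polarEncode Q D y) ρ : ℤ) + (if ρ = 0 then 1 else 0) =
      P ^ 2 + ε * P *
        (if Q y = 0 then (if ρ = 0 then (q : ℤ) - 1 else 0) else (if ρ = 0 then 0 else 1)) := by
    intro y hy ρ
    rw [← hpol y hy ρ, ← symbolCount_polarEncode hD]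
    push_cast
    rfl
  have hB0 : ∀ y, y ≠ 0 → Q y = 0 → symbolCount (polarEncode Q D y) 0 = u := fun y hy hQy => by
    have h := hsc y hy 0
    simp only [hQy, if_true] at h
    zify
    linarith
  have hB1 : ∀ y, y ≠ 0 → Q y = 0 → ∀ ρ ≠ 0, symbolCount (polarEncode Q D y) ρ = W :=
    fun y hy hQy ρ hρ => by
    have h := hsc y hy ρ
    simp only [hQy, hρ, if_true, if_false] at h
    zify
    linarith
  have hne : ∀ y, Q y ≠ 0 → y ≠ 0 := by
    rintro _ h rfl
    exact h (map_zero Q)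
  have hC0 : ∀ y, Q y ≠ 0 → symbolCount (polarEncode Q D y) 0 = W - 1 := fun y hQy => by
    have h := hsc y (hne y hQy) 0
    simp only [hQy, if_true, if_false] at h
    zify [hW0]
    linarith
  have hC1 : ∀ y, Q y ≠ 0 → ∀ ρ ≠ 0, symbolCount (polarEncode Q D y) ρ = v :=
    fun y hQy ρ hρ => by
    have h := hsc y (hne y hQy) ρ
    simp only [hQy, hρ, if_false] at h
    zify
    linarith
  have hA0 : symbolCount (polarEncode Q D 0) 0 = D.card := by simp [symbolCount]
  have hA1 : ∀ ρ ≠ 0, symbolCount (polarEncode Q D 0) ρ = 0 := fun ρ hρ => by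
    simp [symbolCount, hρ.symm]
  have hinj : Function.Injective (polarEncode Q D) := by
    rw [injective_iff_map_eq_zero]
    intro y hy
    by_contra hy0
    have h1 : symbolCount (polarEncode Q D y) 1 = 0 := by simp [hy, symbolCount]
    by_cases hQy : Q y = 0
    · rw [hB1 y hy0 hQy 1 one_ne_zero] at h1
      omega
    · rw [hC1 y hQy 1 one_ne_zero] at h1
      omega
  have hwA : hammingNorm (polarEncode Q D 0) = 0 := by simp
  have hwB : ∀ y, y ≠ 0 → Q y = 0 → hammingNorm (polarEncode Q D y) = (q - 1) * W :=
    fun y hy hQy => by rw [hammingNorm_of_symbolCount (hB1 y hy hQy), hK]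
  have hwC : ∀ y, Q y ≠ 0 → hammingNorm (polarEncode Q D y) = (q - 1) * v :=
    fun y hQy => by rw [hammingNorm_of_symbolCount (hC1 y hQy), hK]
  refine ⟨D.card, u, v, hDcard, hu.symm, hv.symm, rfl, ?_, ?_, ?_, ?_⟩
  · rw [LinearMap.finrank_range_of_inj hinj]
    have h := Module.card_eq_pow_finrank (K := K) (V := V)
    rw [hV, hK] at h
    rw [← Nat.pow_right_injective (by omega : 2 ≤ q) h]
  · have hcount : ∀ i, (weightCount (LinearMap.range (polarEncode Q D)) i : ℤ) =
        (if 0 = i then 1 else 0) + N * (if (q - 1) * W = i then 1 else 0) +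
          M * (if (q - 1) * v = i then 1 else 0) := by
      intro i
      rw [weightCount_range hinj, Finset.card_filter]
      push_cast
      rw [sum_of_quadratic_classes hcN hcM (by rw [hwA])
        (fun y hy hQy => by rw [hwB y hy hQy]) (fun y hQy => by rw [hwC y hQy])]
      simp
    have hset : (Finset.Icc 1 (Fintype.card D)).filter
        (fun i => weightCount (LinearMap.range (polarEncode Q D)) i ≠ 0) =
        {(q - 1) * W, (q - 1) * v} := by
      ext i
      simp only [Finset.mem_filter, Finset.mem_Icc, Finset.mem_insert, Finset.mem_singleton]
      have hi := hcount i
      constructor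
      · rintro ⟨⟨h1, -⟩, h2⟩
        by_contra! h3
        rw [if_neg (by omega), if_neg h3.1.symm, if_neg h3.2.symm] at hi
        exact h2 (by simpa using hi)
      · intro h
        have hpos : 0 < i := by
          rcases h with rfl | rfl <;> exact Nat.mul_pos (by omega) (by assumption)
        have hcne : weightCount (LinearMap.range (polarEncode Q D)) i ≠ 0 := by
          intro h2
          rw [h2] at hi
          rcases h with rfl | rfl <;> split_ifs at hi <;> simp at hi <;> omega
        refine ⟨⟨hpos, ?_⟩, hcne⟩
        rw [weightCount_range hinj] at hcne
        obtain ⟨y, hy⟩ := Finset.card_ne_zero.1 hcne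
        rw [← (Finset.mem_filter.1 hy).2]
        exact hammingNorm_le_card_fintype
    rw [IsTWeight, hset, Finset.card_pair]
    intro h
    exact hvW (Nat.eq_of_mul_eq_mul_left (by omega) h).symm
  · rw [weightEnumerator_range hinj, sum_of_quadratic_classes hcN hcM (by rw [hwA])
        (fun y hy hQy => by rw [hwB y hy hQy]) (fun y hQy => by rw [hwC y hQy])]
    simp
  · rw [completeWeightEnumerator_range hinj, sum_of_quadratic_classes hcN hcM
        (wordCWE_of_symbolCount hA1)
        (fun y hy hQy => by rw [wordCWE_of_symbolCount (hB1 y hy hQy), hB0 y hy hQy])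
        (fun y hQy => by rw [wordCWE_of_symbolCount (hC1 y hQy), hC0 y hQy])]
    rw [hA0]
    simp [mul_assoc]

end PolarCode

/-- Trace forms and polar forms give the same linear functionals, hence the same code. -/
lemma traceCode_eq_range_polarEncode {p : ℕ} [Fact p.Prime] {F : Type*} [Field F]
    [Fintype F] [Algebra (ZMod p) F] {Q : QuadraticForm (ZMod p) F}
    (hQ : ∀ x, (∀ y, QuadraticMap.polar Q x y = 0) → x = 0) (D : Finset F) :
    traceCode p D = LinearMap.range (polarEncode Q D) := by
  have hB : LinearMap.BilinForm.Nondegenerate (QuadraticMap.polarBilin Q) := by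
    refine (LinearMap.IsRefl.nondegenerate_iff_separatingLeft fun x y h => ?_).2 fun x hx => hQ x hx
    rw [QuadraticMap.polarBilin_apply_apply] at h ⊢
    rwa [QuadraticMap.polar_comm]
  apply le_antisymm
  · rintro _ ⟨b, rfl⟩
    refine ⟨(LinearMap.BilinForm.toDual (QuadraticMap.polarBilin Q) hB).symm
      (Algebra.traceForm (ZMod p) F b), ?_⟩
    ext x
    rw [polarEncode_apply, ← QuadraticMap.polarBilin_apply_apply,
      LinearMap.BilinForm.apply_toDual_symm_apply]
    rfl
  · rintro _ ⟨y, rfl⟩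
    refine ⟨(LinearMap.BilinForm.toDual (Algebra.traceForm (ZMod p) F)
      (traceForm_nondegenerate (ZMod p) F)).symm
      (QuadraticMap.polarBilin Q y), ?_⟩
    ext x
    rw [polarEncode_apply, ← QuadraticMap.polarBilin_apply_apply]
    exact LinearMap.BilinForm.apply_toDual_symm_apply (B := Algebra.traceForm (ZMod p) F) _ _

end LinCode

end

theorem theorem1 (p : ℕ) [Fact p.Prime] (hp : Odd p)
    (e m k d s : ℕ) (hk : 0 < k) (hm : 1 < m) (he : e = 2 * m)
    (hd : d = Nat.gcd k e) (hev : Even (e / d)) (hs : s = m / d)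
    {F : Type*} [Field F] [Fintype F] [Algebra (ZMod p) F] (hF : Fintype.card F = p ^ e)
    (a : F) (ha : a ≠ 0)
    (has : a ^ ((p ^ e - 1) / (p ^ d + 1)) ≠ (-1 : F) ^ s) :
    -- `n`, `u`, `v` are the natural numbers given by the three integer formulas
    ∃ n u v : ℕ,
      (n : ℤ) = (p : ℤ) ^ (e - 1) + (-1) ^ s * ((p : ℤ) - 1) * (p : ℤ) ^ (m - 1) - 1 ∧
      (u : ℤ) = (p : ℤ) ^ (e - 2) + (-1) ^ s * ((p : ℤ) - 1) * (p : ℤ) ^ (m - 1) - 1 ∧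
      (v : ℤ) = (p : ℤ) ^ (e - 2) + (-1) ^ s * (p : ℤ) ^ (m - 1) ∧
      -- length and dimension
      (LinCode.definingSet p k a 0).card = n ∧
      Module.finrank (ZMod p) (LinCode.traceCode p (LinCode.definingSet p k a 0)) = e ∧
      -- two-weight code
      LinCode.IsTWeight 2 (LinCode.traceCode p (LinCode.definingSet p k a 0)) ∧
      -- weight enumerator
      LinCode.weightEnumerator (LinCode.traceCode p (LinCode.definingSet p k a 0)) =
        1 + Polynomial.C ((p : ℤ) ^ (e - 1) + (-1) ^ s * ((p : ℤ) - 1) * (p : ℤ) ^ (m - 1) - 1)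
              * Polynomial.X ^ ((p - 1) * p ^ (e - 2))
          + Polynomial.C (((p : ℤ) - 1) * ((p : ℤ) ^ (e - 1) - (-1) ^ s * (p : ℤ) ^ (m - 1)))
              * Polynomial.X ^ ((p - 1) * v) ∧
      -- complete weight enumerator
      LinCode.completeWeightEnumerator (LinCode.traceCode p (LinCode.definingSet p k a 0)) =
        MvPolynomial.X (0 : ZMod p) ^ n
          + MvPolynomial.C
                ((p : ℤ) ^ (e - 1) + (-1) ^ s * ((p : ℤ) - 1) * (p : ℤ) ^ (m - 1) - 1)
              * MvPolynomial.X (0 : ZMod p) ^ u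
              * ∏ ρ ∈ Finset.univ.erase (0 : ZMod p), MvPolynomial.X ρ ^ (p ^ (e - 2))
          + MvPolynomial.C
                (((p : ℤ) - 1) * ((p : ℤ) ^ (e - 1) - (-1) ^ s * (p : ℤ) ^ (m - 1)))
              * MvPolynomial.X (0 : ZMod p) ^ (p ^ (e - 2) - 1)
              * ∏ ρ ∈ Finset.univ.erase (0 : ZMod p), MvPolynomial.X ρ ^ v := by
  have hp3 : 3 ≤ p := by
    have h2 := (Fact.out : p.Prime).two_le
    rcases hp with ⟨r, rfl⟩
    omega
  have hd0 : 0 < d := hd ▸ Nat.gcd_pos_of_pos_left _ hk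
  obtain ⟨j, hkj⟩ : d ∣ k := hd ▸ Nat.gcd_dvd_left k e
  obtain ⟨i, hei⟩ : d ∣ e := hd ▸ Nat.gcd_dvd_right k e
  rw [hei, Nat.mul_div_cancel_left _ hd0] at hev
  obtain ⟨r, hr⟩ := hev
  have hmr : m = d * r := by
    have : 2 * m = 2 * (d * r) := by rw [← he, hei, hr]; ring
    omega
  obtain rfl : s = r := by rw [hs, hmr, Nat.mul_div_cancel_left _ hd0]
  have hes : e = 2 * d * s := by rw [he, hmr]; ring
  -- `k / d` is coprime to `e / d = 2 s`, hence odd.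
  have hcop : Nat.Coprime j (2 * s) := by
    apply Nat.eq_of_mul_eq_mul_left hd0
    rw [← Nat.gcd_mul_left, ← hkj, mul_one]
    conv_rhs => rw [hd]
    rw [hes]
    ring_nf
  have hj : Odd j := by
    rw [← Nat.not_even_iff_odd, even_iff_two_dvd]
    intro h
    have := Nat.dvd_gcd h (dvd_mul_right 2 s)
    rw [hcop.gcd_eq_one] at this
    omega
  have hjs : Nat.Coprime j s := hcop.coprime_dvd_right (dvd_mul_left s 2)
  have hψ : (ZMod.stdAddChar : AddChar (ZMod p) ℂ) ≠ 1 := by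
    intro h
    exact one_ne_zero (ZMod.injective_stdAddChar (N := p) (a₁ := 1) (a₂ := 0) (by simp [h]))
  have hQ := LinCode.frobeniusForm_nondegenerate hp hF hes hkj hj hjs ha has
  have hsim := LinCode.frobeniusForm_similitude (a := a) hp hF hes hkj hj
  have hG := LinCode.sum_addChar_frobeniusForm hψ hp hd0 hF hes hmr hkj hj hjs ha has
  subst he
  rw [LinCode.traceCode_eq_range_polarEncode hQ]
  convert LinCode.polarCode_enumerators (ZMod.card p) hp3 hm hF (neg_one_pow_eq_or ℤ s)
    (LinCode.card_quadratic_eq_zero hψ (ZMod.card p) (by omega) hF hsim hG)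
    (fun y hy ρ => LinCode.card_quadratic_zero_polar hψ (ZMod.card p) (by omega) hF hQ hsim hG hy ρ)
    (D := LinCode.definingSet p k a 0)
    (by simp [LinCode.definingSet, LinCode.frobeniusForm_apply])
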